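/- Let $q$ be a positive integer of the form $q=16(6s+1)+4$ or $q=16(6s-1)+4$ with $s\in\mathbb{Z}$, and let $Q_q=\{0,\dots,q-1\}$. Then there exists an $MDS(2,5,q)$ code, that is, a set $C\subset Q_q^5$ such that $|C\cap\Gamma|=1$ for every $2$-dimensional axis-aligned plane $\Gamma$ of $Q_q^5$ (a set obtained by letting two of the five coordinates vary freely and fixing the other three). Moreover, $C$ can be written as $$C=\{(x_1,x_2,x_3,f(x_1,x_2,x_3),g(x_1,x_2,x_3)) : x_1,x_2,x_3\in Q_q\},$$ where $f,g:Q_q^3\to Q_q$ form a pair of orthogonal latin cubes of order $q$: each of $f,g$ takes every value exactly once on every axis-aligned line of $Q_q^3$, and on every $2$-dimensional axis-aligned face of $Q_q^3$ the pair $(f,g)$ takes every value in $Q_q\times Q_q$ exactly once. -/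

import Mathlib

/-- The axis-aligned plane of `Q_q^d` through `x` whose free coordinates are those in `S`;
it has dimension `S.card`. -/
def axisPlane {d q : ℕ} (S : Finset (Fin d)) (x : Fin d → Fin q) : Set (Fin d → Fin q) :=
  {y | ∀ i, i ∉ S → y i = x i}

/-- `C ⊆ Q_q^d` is an `MDS(t,d,q)` code: it meets every `t`-dimensional axis-aligned plane
in exactly one point. -/
def IsMDSCode (t d q : ℕ) (C : Set (Fin d → Fin q)) : Prop :=
  ∀ (S : Finset (Fin d)) (x : Fin d → Fin q), S.card = t → ∃! y, y ∈ C ∩ axisPlane S x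

/-- A `k`-dimensional array of order `q` is a latin `k`-cube: on every axis-aligned line each
symbol occurs exactly once. -/
def IsLatinCube {k q : ℕ} (f : (Fin k → Fin q) → Fin q) : Prop :=
  ∀ (i : Fin k) (x : Fin k → Fin q),
    Function.Bijective fun a : Fin q => f (Function.update x i a)

/-- Two latin `k`-cubes are orthogonal: on every pair of corresponding two-dimensional
axis-aligned faces, each ordered pair of symbols appears exactly once in the superposition. -/
def AreOrthogonalLatinCubes {k q : ℕ} (f g : (Fin k → Fin q) → Fin q) : Prop :=
  IsLatinCube f ∧ IsLatinCube g ∧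
    ∀ (i j : Fin k) (x : Fin k → Fin q), i ≠ j →
      Function.Bijective fun p : Fin q × Fin q =>
        (f (Function.update (Function.update x i p.1) j p.2),
          g (Function.update (Function.update x i p.1) j p.2))

/-!
A pair of orthogonal latin cubes is the same thing as a code of length five in which any three
places can be prescribed arbitrarily and determine the word (`HasStrengthThree`): the first three
places are the arguments and the last two the values. Such a code is built here for the orders
`16 * m + 4` with `m` prime to `6`, which are the orders in question.

The alphabet consists of `m` groups of `16` symbols and a hole of `4` symbols. The groups visited by
a codeword are the values at `0, 1, 2, 3, 4` of a polynomial of degree at most two over `ℤ/m`; since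
the differences of these points are units, polynomials of degree at most `2 - j` are determined by
`3 - j` values (`existsUnique_polyWord`). Over each polynomial sits a code on a single group
together with the hole, chosen by the degree:

* over degree two, a code of strength three on the group alone;
* over degree one, a code which covers each pattern on three places having at most one symbol in the
  hole exactly once, and covers no pattern having more (`existsUnique_sparseWord`);
* over constants, a code of strength three on all `20` symbols, in which three symbols in the hole
  force all five to be there (`hasStrengthThree_holeCode`).

A pattern with `j ≤ 2` symbols in the hole prescribes `3 - j` group indices, and is covered
precisely over polynomials of degree at most `2 - j`: the polynomial is determined, and then the
word. For `j = 3` the polynomial is any constant, but the word lies in the hole and does not depend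
on it (`hasStrengthThree_wilsonCode`).

The sparse code over degree one is the substantial ingredient. It is assembled from cosets of a
quasi-cyclic `𝔽₂`-linear code `L` of dimension ten and length five over `𝔽₂⁴`: two cosets consist of
words avoiding the hole, and in five others, one for each place, the symbol in that place is
replaced by its image in a quotient `𝔽₂²`, read as a symbol of the hole. The number `7 * 1024`
of words equals the number `16 ^ 3 + 3 * 4 * 16 ^ 2` of admissible patterns on three places, so it suffices
that two words agree in at most two places. By linearity this concerns only differences of words,
which lie in a few cosets of `L` and are checked by evaluation (`sparse_check_ne`,
`sparse_check_eq`).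
-/

/-- Any three places of a word of `C` can be prescribed arbitrarily, and determine the word. -/
def HasStrengthThree {α : Type*} (C : Set (Fin 5 → α)) : Prop :=
  ∀ e : Fin 3 → Fin 5, Function.Injective e → ∀ v : Fin 3 → α, ∃! w, w ∈ C ∧ ∀ t, w (e t) = v t

/-- An alphabet made of the symbols `(some a, u)` and a hole of four symbols `(none, u)`. -/
abbrev Holed (α : Type*) := Option α × Fin 4

/-! ### Linear combinations over `𝔽₂` -/

/-- The `𝔽₂`-linear combination (bitwise exclusive or) of the numbers in a list whose coefficients
are the binary digits of `m`. -/
def xorComb : List ℕ → ℕ → ℕ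
  | [], _ => 0
  | b :: bs, m => m % 2 * b ^^^ xorComb bs (m / 2)

theorem xorComb_xor (bs : List ℕ) (m n : ℕ) :
    xorComb bs (m ^^^ n) = xorComb bs m ^^^ xorComb bs n := by
  induction bs generalizing m n with
  | nil => simp [xorComb]
  | cons b bs ih =>
    have h2 : (m ^^^ n) / 2 = m / 2 ^^^ n / 2 := by
      simpa [Nat.shiftRight_eq_div_pow] using Nat.shiftRight_xor_distrib (a := m) (b := n) (i := 1)
    have h1 : (m ^^^ n) % 2 * b = m % 2 * b ^^^ n % 2 * b := by
      have := Nat.xor_mod_two_pow (a := m) (b := n) (n := 1)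
      rw [pow_one] at this
      rw [this]
      rcases Nat.mod_two_eq_zero_or_one m with h | h <;>
        rcases Nat.mod_two_eq_zero_or_one n with h' | h' <;> simp [h, h']
    simp only [xorComb, h1, h2, ih]
    ac_rfl

/-- The `k`-th hexadecimal digit of `x`. -/
def hexDigit (x k : ℕ) : ℕ := x >>> (4 * k) % 16

theorem hexDigit_xor (x y k : ℕ) : hexDigit (x ^^^ y) k = hexDigit x k ^^^ hexDigit y k := by
  simp only [hexDigit, Nat.shiftRight_xor_distrib]
  exact Nat.xor_mod_two_pow (n := 4)

theorem xor_mod_four (x y : ℕ) : (x ^^^ y) % 4 = x % 4 ^^^ y % 4 :=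
  Nat.xor_mod_two_pow (n := 2)

/-- Does `p` hold on the whole coset `x + span bs`? -/
def allComb (p : ℕ → Bool) : List ℕ → ℕ → Bool
  | [], x => p x
  | b :: bs, x => allComb p bs x && allComb p bs (x ^^^ b)

/-- Does `p` hold at `x` plus every combination of `bs` with some nonzero coefficient? -/
def allNonzeroComb (p : ℕ → Bool) : List ℕ → ℕ → Bool
  | [], _ => true
  | b :: bs, x => allNonzeroComb p bs x && allComb p bs (x ^^^ b)

theorem allComb_apply {p : ℕ → Bool} {bs : List ℕ} {x : ℕ} (h : allComb p bs x = true) (m : ℕ) :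
    p (x ^^^ xorComb bs m) = true := by
  induction bs generalizing x m with
  | nil => simpa [xorComb, allComb] using h
  | cons b bs ih =>
    rw [allComb, Bool.and_eq_true] at h
    rcases Nat.mod_two_eq_zero_or_one m with hm | hm
    · simpa [xorComb, hm] using ih h.1 (m / 2)
    · simpa [xorComb, hm, Nat.xor_assoc] using ih h.2 (m / 2)

theorem allNonzeroComb_apply {p : ℕ → Bool} {bs : List ℕ} {x : ℕ}
    (h : allNonzeroComb p bs x = true) {m : ℕ} (hm : m < 2 ^ bs.length) (hm0 : m ≠ 0) :
    p (x ^^^ xorComb bs m) = true := by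
  induction bs generalizing x m with
  | nil => simp at hm; omega
  | cons b bs ih =>
    rw [allNonzeroComb, Bool.and_eq_true] at h
    rw [List.length_cons, pow_succ] at hm
    rcases Nat.mod_two_eq_zero_or_one m with h2 | h2
    · simpa [xorComb, h2] using ih h.1 (m := m / 2) (by omega) (by omega)
    · simpa [xorComb, h2, Nat.xor_assoc] using allComb_apply h.2 (m / 2)

/-! ### Data of the sparse code -/

/-- A basis of a ten-dimensional `𝔽₂`-space of words of five hexadecimal digits: the cyclic
rotations of `0x02055` and of `0x00939`, which were found by computer. -/
def sparseBasis : List ℕ :=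
  [0x02055, 0x20550, 0x05502, 0x55020, 0x50205, 0x00939, 0x09390, 0x93900, 0x39009, 0x90093]

/-- The translations giving the seven classes of the sparse code from the span of `sparseBasis`: the
cyclic rotations of `0x83000` for the classes `0, …, 4`, and two constant words. -/
def sparseShift : ℕ → ℕ
  | 0 => 0x83000
  | 1 => 0x30008
  | 2 => 0x00083
  | 3 => 0x00830
  | 4 => 0x08300
  | 5 => 0x00000
  | _ => 0x44444

/-- Can words of the classes `a` and `b` with difference `d` agree in place `k`? Place `k` is in
the hole exactly for class `k`. Two symbols in the hole agree when their digits agree modulo `4`; a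
symbol in the hole differs from one outside it. -/
def sparseAgree (a b d k : ℕ) : Bool :=
  bif a == k then bif b == k then hexDigit d k % 4 == 0 else false
  else bif b == k then false else hexDigit d k == 0

/-- At most two of `s 0, …, s 4` are `true`. -/
def atMostTwo (s : ℕ → Bool) : Bool :=
  bif s 0 then bif s 1 then !(s 2 || s 3 || s 4) else bif s 2 then !(s 3 || s 4) else !(s 3 && s 4)
  else bif s 1 then bif s 2 then !(s 3 || s 4) else !(s 3 && s 4) else !(s 2 && s 3 && s 4)

/-- Words of different classes agree in at most two places. -/
theorem sparse_check_ne : ∀ a < 7, ∀ b < a,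
    allComb (fun d => atMostTwo (sparseAgree a b d)) sparseBasis (sparseShift a ^^^ sparseShift b)
      = true := by
  decide +kernel

/-- Different words of the same class agree in at most two places. -/
theorem sparse_check_eq : ∀ a < 7,
    allNonzeroComb (fun d => atMostTwo (sparseAgree a a d)) sparseBasis 0 = true := by
  decide +kernel

/-! ### The sparse code -/

theorem atMostTwo_exists {s : ℕ → Bool} (h : atMostTwo s = true) {e : Fin 3 → Fin 5}
    (he : Function.Injective e) : ∃ t, s (e t) = false := by
  by_contra! hs
  have key : ∀ r : Fin 5 → Bool,
      atMostTwo (fun k => if h : k < 5 then r ⟨k, h⟩ else false) = true →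
      ∀ i j k : Fin 5, r i = true → r j = true → r k = true → i = j ∨ i = k ∨ j = k := by
    decide
  have h' : atMostTwo (fun k => if h : k < 5 then (fun k : Fin 5 => s k) ⟨k, h⟩ else false)
      = true := by
    simpa [atMostTwo] using h
  have hs' : ∀ t, s (e t) = true := fun t => by simpa using hs t
  rcases key (fun k => s k) h' (e 0) (e 1) (e 2) (hs' 0) (hs' 1) (hs' 2) with h | h | h <;>
    exact absurd (he h) (by decide)

/-- The words of the sparse code, in seven classes of `1024`. The hexadecimal digit `d` in place `k`
stands for the symbol `(d / 4, d % 4)`, but in class `a < 5` the symbol in place `a` is in the hole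
and keeps only `d % 4`; words of the classes `5` and `6` avoid the hole. -/
def sparseWord (i : Fin 7 × Fin 1024) (k : Fin 5) : Holed (Fin 4) :=
  (if (i.1 : ℕ) = k then none
    else some (Fin.ofNat 4 (hexDigit (xorComb sparseBasis i.2 ^^^ sparseShift i.1) k / 4)),
    Fin.ofNat 4 (hexDigit (xorComb sparseBasis i.2 ^^^ sparseShift i.1) k))

/-- Words agreeing in place `k` have a difference that `sparseAgree` accepts there. -/
theorem sparseAgree_of_eq {i j : Fin 7 × Fin 1024} {k : Fin 5}
    (h : sparseWord i k = sparseWord j k) :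
    sparseAgree i.1 j.1 ((sparseShift i.1 ^^^ sparseShift j.1) ^^^
      xorComb sparseBasis (i.2 ^^^ j.2 : ℕ)) k = true := by
  have hx : (sparseShift i.1 ^^^ sparseShift j.1) ^^^ xorComb sparseBasis (i.2 ^^^ j.2 : ℕ) =
      (xorComb sparseBasis i.2 ^^^ sparseShift i.1) ^^^
        (xorComb sparseBasis j.2 ^^^ sparseShift j.1) := by
    rw [xorComb_xor]; ac_rfl
  rw [hx, sparseAgree, hexDigit_xor, xor_mod_four]
  simp only [sparseWord, Prod.mk.injEq, Fin.ext_iff, Fin.val_ofNat] at h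
  obtain ⟨h1, h2⟩ := h
  have b1 : hexDigit (xorComb sparseBasis i.2 ^^^ sparseShift i.1) k < 16 :=
    Nat.mod_lt _ (by norm_num)
  have b2 : hexDigit (xorComb sparseBasis j.2 ^^^ sparseShift j.1) k < 16 :=
    Nat.mod_lt _ (by norm_num)
  generalize hexDigit (xorComb sparseBasis i.2 ^^^ sparseShift i.1) k = x at *
  generalize hexDigit (xorComb sparseBasis j.2 ^^^ sparseShift j.1) k = y at *
  by_cases hi : (i.1 : ℕ) = k <;> by_cases hj : (j.1 : ℕ) = k <;>
    simp only [hi, hj, if_true, if_false, reduceCtorEq, Option.some.injEq, Fin.ext_iff,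
      Fin.val_ofNat] at h1
  · simp [hi, hj, h2]
  · have : x = y := by omega
    simp [hi, hj, this]

/-- Words that agree in three places are equal. -/
theorem sparseWord_injective {e : Fin 3 → Fin 5} (he : Function.Injective e) :
    Function.Injective fun i t => sparseWord i (e t) := by
  -- A word of a later class never agrees with one of an earlier class in three places.
  have aux : ∀ i j : Fin 7 × Fin 1024, (∀ t, sparseWord i (e t) = sparseWord j (e t)) →
      ¬ j.1 < i.1 := by
    intro i j h hlt
    obtain ⟨t, ht⟩ := atMostTwo_exists
      (allComb_apply (sparse_check_ne i.1 i.1.2 j.1 hlt) (i.2 ^^^ j.2 : ℕ)) he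
    exact Bool.false_ne_true (ht.symm.trans (sparseAgree_of_eq (h t)))
  intro i j h
  replace h := fun t => congrFun h t
  have h1 : i.1 = j.1 := le_antisymm (not_lt.1 (aux i j h)) (not_lt.1 (aux j i fun t => (h t).symm))
  refine Prod.ext h1 ?_
  by_contra h2
  have hne : (i.2 ^^^ j.2 : ℕ) ≠ 0 := by
    rw [Ne, Nat.xor_eq_zero_iff]
    exact fun h => h2 (Fin.ext h)
  obtain ⟨t, ht⟩ := atMostTwo_exists (allNonzeroComb_apply (sparse_check_eq i.1 i.1.2)
    (Nat.xor_lt_two_pow (n := 10) i.2.2 j.2.2) hne) he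
  have := sparseAgree_of_eq (h t)
  rw [← h1, Nat.xor_self] at this
  exact Bool.false_ne_true (ht.symm.trans this)

/-- The number of coordinates of `v` that lie in the hole. -/
def holeCount {α : Type*} {n : ℕ} (v : Fin n → Holed α) : ℕ :=
  (Finset.univ.filter fun t => (v t).1.isNone = true).card

/-- Of the patterns on three places, `16 ^ 3` avoid the hole and `3 * 4 * 16 ^ 2` meet it once. -/
theorem card_holeCount_le_one :
    Fintype.card {v : Fin 3 → Holed (Fin 4) // holeCount v ≤ 1} ≤ 7168 := by
  -- A pattern has no coordinate in the hole, or exactly one, whose position is `p`.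
  let f : (Fin 3 → Fin 4 × Fin 4) ⊕ (Fin 3 × Fin 4 × (Fin 2 → Fin 4 × Fin 4)) →
      (Fin 3 → Holed (Fin 4)) :=
    Sum.elim (fun v t => (some (v t).1, (v t).2))
      fun w => w.1.insertNth (none, w.2.1) fun t => (some (w.2.2 t).1, (w.2.2 t).2)
  have hf : ∀ v : Fin 3 → Holed (Fin 4), holeCount v ≤ 1 → v ∈ Set.range f := by
    intro v hv
    by_cases h : ∃ p, (v p).1 = none
    · obtain ⟨p, hp⟩ := h
      have ho : ∀ t : Fin 2, ∃ a, (v (p.succAbove t)).1 = some a := by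
        intro t
        rw [← Option.ne_none_iff_exists']
        intro ht
        have := Finset.card_le_one.1 hv p (by simp [hp]) (p.succAbove t) (by simp [ht])
        exact Fin.succAbove_ne p t this.symm
      choose a ha using ho
      refine ⟨Sum.inr (p, (v p).2, fun t => (a t, (v (p.succAbove t)).2)), ?_⟩
      funext t
      rcases Fin.eq_self_or_eq_succAbove p t with rfl | ⟨t, rfl⟩
      · simp [f, ← hp]
      · simp [f, ← ha]
    · push Not at h
      choose a ha using fun t => Option.ne_none_iff_exists'.1 (h t)
      exact ⟨Sum.inl fun t => (a t, (v t).2), by funext t; simp [f, ← ha]⟩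
  calc _ ≤ Fintype.card ((Fin 3 → Fin 4 × Fin 4) ⊕ (Fin 3 × Fin 4 × (Fin 2 → Fin 4 × Fin 4))) := by
        choose g hg using hf
        refine Fintype.card_le_of_injective (fun v => g v.1 v.2) fun v w h => Subtype.ext ?_
        rw [← hg v.1 v.2, ← hg w.1 w.2]
        exact congrArg f h
    _ = 7168 := by simp

theorem holeCount_sparseWord_le (i : Fin 7 × Fin 1024) {e : Fin 3 → Fin 5}
    (he : Function.Injective e) : holeCount (fun t => sparseWord i (e t)) ≤ 1 := by
  refine Finset.card_le_one.2 fun s hs t ht => he (Fin.ext ?_)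
  have key : ∀ t, (sparseWord i (e t)).1.isNone = true → (i.1 : ℕ) = e t := by
    intro t h
    by_contra hne
    simp [sparseWord, hne] at h
  rw [← key s (by simpa using hs), ← key t (by simpa using ht)]

/-- There are as many words as patterns with at most one coordinate in the hole, so the injective
restriction of words to three places is bijective. -/
theorem existsUnique_sparseWord {e : Fin 3 → Fin 5} (he : Function.Injective e)
    {v : Fin 3 → Holed (Fin 4)} (hv : holeCount v ≤ 1) :
    ∃! x, x ∈ Set.range sparseWord ∧ ∀ t, x (e t) = v t := by
  let r : Fin 7 × Fin 1024 → {v : Fin 3 → Holed (Fin 4) // holeCount v ≤ 1} :=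
    fun i => ⟨fun t => sparseWord i (e t), holeCount_sparseWord_le i he⟩
  have hr : Function.Injective r := fun i j h => sparseWord_injective he (congrArg Subtype.val h)
  have hb : Function.Bijective r :=
    (Fintype.bijective_iff_injective_and_card r).2 ⟨hr, le_antisymm
      (Fintype.card_le_of_injective r hr) (card_holeCount_le_one.trans (by simp))⟩
  obtain ⟨i, hi⟩ := hb.2 ⟨v, hv⟩
  have hi' := congrArg Subtype.val hi
  refine ⟨sparseWord i, ⟨⟨i, rfl⟩, congrFun hi'⟩, ?_⟩
  rintro _ ⟨⟨j, rfl⟩, hj⟩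
  rw [sparseWord_injective he ((funext hj).trans hi'.symm)]

/-! ### The code over the field with four elements -/

theorem existsUnique_word {I α : Type*} [Fintype I] [Fintype α] {word : I → Fin 5 → α}
    {e : Fin 3 → Fin 5} (hI : Fintype.card I = Fintype.card α ^ 3)
    (hw : Function.Injective fun i t => word i (e t)) (v : Fin 3 → α) :
    ∃! i, ∀ t, word i (e t) = v t := by
  classical
  have hb : Function.Bijective fun i t => word i (e t) :=
    (Fintype.bijective_iff_injective_and_card _).2 ⟨hw, by simp [hI]⟩
  simpa only [funext_iff] using hb.existsUnique v

/-- Multiplication by a primitive element `ω` of the field with four elements, whose elements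
`0, 1, ω, ω + 1` are encoded as `0, 1, 2, 3`; addition is then bitwise exclusive or. -/
def mulOmega : Fin 4 → Fin 4 := ![0, 2, 3, 1]

/-- The words of a linear code of length five, dimension three and distance three over `𝔽₄`. -/
def fourWord (c : Fin 4 × Fin 4 × Fin 4) : Fin 5 → Fin 4 :=
  ![c.1, c.2.1, c.2.2, c.1 ^^^ c.2.1 ^^^ c.2.2,
    c.1 ^^^ mulOmega c.2.1 ^^^ mulOmega (mulOmega c.2.2)]

theorem fourWord_check : ∀ c d, c ≠ d →
    atMostTwo (fun k => fourWord c (Fin.ofNat 5 k) == fourWord d (Fin.ofNat 5 k)) = true := by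
  decide +kernel

theorem existsUnique_fourWord {e : Fin 3 → Fin 5} (he : Function.Injective e) (v : Fin 3 → Fin 4) :
    ∃! c, ∀ t, fourWord c (e t) = v t := by
  refine existsUnique_word (by simp) (fun c d h => ?_) v
  by_contra hcd
  obtain ⟨t, ht⟩ := atMostTwo_exists (fourWord_check c d hcd) he
  simp [congrFun h t] at ht

/-! ### Quadratic polynomials modulo `m` -/

/-- The values of the polynomial `c 0 + c 1 * X + c 2 * X ^ 2` at `0, 1, 2, 3, 4` modulo `m`. -/
def polyWord {m : ℕ} (c : Fin 3 → ZMod m) (k : Fin 5) : ZMod m :=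
  c 0 + c 1 * (k : ℕ) + c 2 * (k : ℕ) ^ 2

theorem isUnit_natCast_sub {m : ℕ} (hm : m.Coprime 6) {i j : Fin 5} (hij : i ≠ j) :
    IsUnit (((i : ℕ) : ZMod m) - ((j : ℕ) : ZMod m)) := by
  wlog h : j < i generalizing i j
  · rw [← neg_sub, IsUnit.neg_iff]
    exact this hij.symm (lt_of_le_of_ne (not_lt.1 h) hij)
  rw [← Nat.cast_sub h.le, ZMod.isUnit_iff_coprime]
  have h2 : Nat.Coprime 2 m := (hm.coprime_dvd_right (by norm_num : 2 ∣ 6)).symm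
  have h3 : Nat.Coprime 3 m := (hm.coprime_dvd_right (by norm_num : 3 ∣ 6)).symm
  have h4 : Nat.Coprime (2 * 2) m := h2.mul_left h2
  have h1 : (i : ℕ) - j ∈ Finset.Icc 1 4 := by rw [Finset.mem_Icc]; omega
  generalize (i : ℕ) - j = d at h1
  fin_cases h1
  exacts [Nat.coprime_one_left m, h2, h3, h4]

/-- Lagrange interpolation at points whose differences are units. -/
theorem existsUnique_interpolation {R : Type*} [CommRing R] {r : ℕ} {p : Fin r → R}
    (hp : ∀ i j, i ≠ j → IsUnit (p i - p j)) (a : Fin r → R) :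
    ∃! c : Fin r → R, ∀ t, ∑ l : Fin r, c l * p t ^ (l : ℕ) = a t := by
  have hdet : IsUnit (Matrix.vandermonde p).det := by
    rw [Matrix.det_vandermonde]
    refine (IsUnit.prod_univ_iff).2 fun i => ?_
    refine IsUnit.prod_iff.2 fun j hj => hp _ _ (Finset.mem_Ioi.1 hj).ne'
  have hb : Function.Bijective (Matrix.vandermonde p).mulVec :=
    ⟨Matrix.mulVec_injective_of_det_mem_nonZeroDivisors hdet.mem_nonZeroDivisors,
      Matrix.mulVec_surjective_iff_isUnit.2 ((Matrix.isUnit_iff_isUnit_det _).2 hdet)⟩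
  simpa only [funext_iff, Matrix.mulVec, dotProduct, Matrix.vandermonde_apply, mul_comm]
    using hb.existsUnique a

/-- Polynomials of degree at most `2 - j` are determined by, and can be prescribed at, any `3 - j`
of the five points. For `j ≤ 2` the condition `l ≠ 0` is automatic; it matches
`coeff_eq_zero_of_mem_ingredient`, where `j = 3` occurs. -/
theorem existsUnique_polyWord {m : ℕ} (hm : m.Coprime 6) {e : Fin 3 → Fin 5}
    (he : Function.Injective e) (N : Finset (Fin 3)) {j : ℕ} (hN : N.card + j = 3) (hj : j ≤ 2)
    (a : Fin 3 → ZMod m) :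
    ∃! c : Fin 3 → ZMod m, (∀ l : Fin 3, l ≠ 0 → 3 ≤ (l : ℕ) + j → c l = 0) ∧
      ∀ t ∈ N, polyWord c (e t) = a t := by
  have hu : ∀ {s t : Fin 3}, s ≠ t → IsUnit (((e s : ℕ) : ZMod m) - ((e t : ℕ) : ZMod m)) :=
    fun h => isUnit_natCast_sub hm (he.ne h)
  interval_cases j
  · obtain rfl : N = Finset.univ := Finset.eq_univ_of_card N hN
    have := existsUnique_interpolation (p := fun t => ((e t : ℕ) : ZMod m)) (fun i j => hu) a
    refine (existsUnique_congr fun c => ?_).1 this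
    simp [Fin.sum_univ_three, polyWord]
  · obtain ⟨s, t, hst, rfl⟩ := Finset.card_eq_two.1 (by omega : N.card = 2)
    obtain ⟨d, hd, hd'⟩ := existsUnique_interpolation
      (p := ![((e s : ℕ) : ZMod m), ((e t : ℕ) : ZMod m)])
      (by simp [Fin.forall_fin_two, hu hst, hu hst.symm]) ![a s, a t]
    simp only [Fin.sum_univ_two, Fin.forall_fin_two] at hd hd'
    refine ⟨![d 0, d 1, 0], ⟨?_, ?_⟩, ?_⟩
    · simp [Fin.forall_fin_succ]
    · simpa [polyWord] using hd
    · rintro c ⟨hc, hc'⟩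
      have h2 := hc 2 (by decide) (by decide)
      have := hd' ![c 0, c 1] (by simpa [polyWord, h2] using hc')
      subst this
      funext l; fin_cases l <;> simp [h2]
  · obtain ⟨s, rfl⟩ := Finset.card_eq_one.1 (by omega : N.card = 1)
    refine ⟨![a s, 0, 0], ⟨?_, ?_⟩, ?_⟩
    · simp [Fin.forall_fin_succ]
    · simp [polyWord]
    · rintro c ⟨hc, hc'⟩
      have h1 := hc 1 (by decide) (by decide)
      have h2 := hc 2 (by decide) (by decide)
      have := hc' s (by simp)
      funext l; fin_cases l <;> simp_all [polyWord]

theorem existsUnique_polyWord_univ {m : ℕ} (hm : m.Coprime 6) {e : Fin 3 → Fin 5}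
    (he : Function.Injective e) (a : Fin 3 → ZMod m) :
    ∃! c : Fin 3 → ZMod m, ∀ t, polyWord c (e t) = a t := by
  refine (existsUnique_congr fun c => ?_).1
    (existsUnique_polyWord hm he Finset.univ (j := 0) (by simp) (by simp) a)
  simp

/-! ### The three ingredients -/

/-- The ingredient avoiding the hole: a product of two copies of the code over `𝔽₄`. -/
def plainCode : Set (Fin 5 → Holed (Fin 4)) :=
  {x | ∃ c d, x = fun k => (some (fourWord c k), fourWord d k)}

/-- The ingredient of full strength: the product of the quadratic code over `ℤ/5` and the code over
`𝔽₄`. The residue `0` is the hole, so three coordinates in the hole force the zero polynomial. -/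
def holeCode : Set (Fin 5 → Holed (Fin 4)) :=
  {x | ∃ (c : Fin 3 → ZMod 5) (d : _), x = fun k => (finSuccEquiv 4 (polyWord c k), fourWord d k)}

theorem holeCount_eq_zero {α : Type*} {n : ℕ} {v : Fin n → Holed α} :
    holeCount v = 0 ↔ ∀ t, ∃ a, (v t).1 = some a := by
  simp [holeCount, Finset.filter_eq_empty_iff, Option.ne_none_iff_exists']

theorem existsUnique_plainCode {e : Fin 3 → Fin 5} (he : Function.Injective e)
    {v : Fin 3 → Holed (Fin 4)} (hv : holeCount v = 0) :
    ∃! x, x ∈ plainCode ∧ ∀ t, x (e t) = v t := by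
  choose a ha using holeCount_eq_zero.1 hv
  obtain ⟨c, hc, hc'⟩ := existsUnique_fourWord he a
  obtain ⟨d, hd, hd'⟩ := existsUnique_fourWord he fun t => (v t).2
  refine ⟨_, ⟨⟨c, d, rfl⟩, fun t => Prod.ext (by simp [hc, ha]) (hd t)⟩, ?_⟩
  rintro _ ⟨⟨c₁, d₁, rfl⟩, h⟩
  simp only [Prod.ext_iff, ha, Option.some.injEq] at h
  rw [hc' c₁ fun t => (h t).1, hd' d₁ fun t => (h t).2]

theorem hasStrengthThree_holeCode : HasStrengthThree holeCode := by
  intro e he v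
  obtain ⟨c, hc, hc'⟩ := existsUnique_polyWord_univ (m := 5) (by norm_num) he
    fun t => (finSuccEquiv 4).symm (v t).1
  obtain ⟨d, hd, hd'⟩ := existsUnique_fourWord he fun t => (v t).2
  refine ⟨_, ⟨⟨c, d, rfl⟩, fun t => Prod.ext (by simp [hc]) (hd t)⟩, ?_⟩
  rintro _ ⟨⟨c₁, d₁, rfl⟩, h⟩
  simp only [Prod.ext_iff] at h
  rw [hc' c₁ fun t => (Equiv.eq_symm_apply _).2 (h t).1, hd' d₁ fun t => (h t).2]

theorem eq_none_of_mem_holeCode {e : Fin 3 → Fin 5} (he : Function.Injective e)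
    {x : Fin 5 → Holed (Fin 4)} (hx : x ∈ holeCode) (h : ∀ t, (x (e t)).1 = none)
    (k : Fin 5) : (x k).1 = none := by
  obtain ⟨c, d, rfl⟩ := hx
  have h0 : c = 0 := (existsUnique_polyWord_univ (m := 5) (by norm_num) he 0).unique
    (fun t => (finSuccEquiv 4).injective ((h t).trans (finSuccEquiv_zero (n := 4)).symm))
    (fun t => by simp [polyWord])
  subst h0
  simp only [polyWord, Pi.zero_apply, zero_mul, add_zero]
  exact finSuccEquiv_zero

/-- The ingredient placed over the polynomial `c 0 + c 1 * k + c 2 * k ^ 2`: it depends on the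
degree, so that patterns with `j` coordinates in the hole are covered over degree at most `2 - j`
only. -/
def ingredient {m : ℕ} (c : Fin 3 → ZMod m) : Set (Fin 5 → Holed (Fin 4)) :=
  {x | (c 2 ≠ 0 ∧ x ∈ plainCode) ∨ (c 2 = 0 ∧ c 1 ≠ 0 ∧ x ∈ Set.range sparseWord) ∨
    (c 2 = 0 ∧ c 1 = 0 ∧ x ∈ holeCode)}

/-- An ingredient word with `j` of three coordinates in the hole lies over a polynomial of degree at
most `2 - j` (over a constant when `j = 3`). -/
theorem coeff_eq_zero_of_mem_ingredient {m : ℕ} {c : Fin 3 → ZMod m} {e : Fin 3 → Fin 5}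
    (he : Function.Injective e) {x : Fin 5 → Holed (Fin 4)} (hx : x ∈ ingredient c)
    {l : Fin 3} (hl : l ≠ 0) (h : 3 ≤ (l : ℕ) + holeCount fun t => x (e t)) : c l = 0 := by
  rcases hx with ⟨-, c₁, d₁, rfl⟩ | ⟨h2, -, i, rfl⟩ | ⟨h2, h1, -⟩
  · rw [holeCount_eq_zero.2 fun t => ⟨_, rfl⟩] at h
    omega
  · have := holeCount_sparseWord_le i he
    obtain rfl : l = 2 := by omega
    exact h2
  · fin_cases l
    exacts [absurd rfl hl, h1, h2]

/-- Over a polynomial of low enough degree the ingredient covers the pattern `v` exactly once. -/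
theorem existsUnique_ingredient {m : ℕ} {c : Fin 3 → ZMod m} {e : Fin 3 → Fin 5}
    (he : Function.Injective e) {v : Fin 3 → Holed (Fin 4)}
    (h : ∀ l : Fin 3, l ≠ 0 → 3 ≤ (l : ℕ) + holeCount v → c l = 0) :
    ∃! x, x ∈ ingredient c ∧ ∀ t, x (e t) = v t := by
  by_cases h2 : c 2 = 0
  · by_cases h1 : c 1 = 0
    · simpa [ingredient, h2, h1] using hasStrengthThree_holeCode e he v
    · have : holeCount v ≤ 1 := by
        by_contra hv
        exact h1 (h 1 (by decide) (by rw [Fin.val_one]; omega))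
      simpa [ingredient, h2, h1] using existsUnique_sparseWord he this
  · have : holeCount v = 0 := by
      by_contra hv
      exact h2 (h 2 (by decide) (by rw [Fin.val_two]; omega))
    simpa [ingredient, h2] using existsUnique_plainCode he this

/-! ### The composite code -/

/-- Place the symbol `x` in the group indexed by `a`; symbols in the hole belong to all groups. -/
def inflate {m : ℕ} (a : ZMod m) (x : Holed (Fin 4)) : Holed (ZMod m × Fin 4) :=
  (x.1.map (a, ·), x.2)

/-- Forget the group index of a symbol. -/
def deflate {m : ℕ} (y : Holed (ZMod m × Fin 4)) : Holed (Fin 4) :=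
  (y.1.map Prod.snd, y.2)

theorem inflate_eq_iff {m : ℕ} {a : ZMod m} {x : Holed (Fin 4)}
    {y : Holed (ZMod m × Fin 4)} :
    inflate a x = y ↔ x = deflate y ∧ ∀ p, y.1 = some p → a = p.1 := by
  obtain ⟨_ | x, u⟩ := x <;> obtain ⟨_ | y, w⟩ := y <;>
    simp [inflate, deflate, Prod.ext_iff, and_comm, and_left_comm]

/-- The composite code, a Wilson-type construction: over each polynomial of degree at most
two, the inflated ingredient. -/
def wilsonCode (m : ℕ) : Set (Fin 5 → Holed (ZMod m × Fin 4)) :=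
  {w | ∃ c, ∃ x ∈ ingredient c, w = fun k => inflate (polyWord c k) (x k)}

theorem hasStrengthThree_wilsonCode {m : ℕ} (hm : m.Coprime 6) :
    HasStrengthThree (wilsonCode m) := by
  intro e he v
  set v₀ : Fin 3 → Holed (Fin 4) := fun t => deflate (v t) with hv₀
  have hmatch : ∀ {c : Fin 3 → ZMod m} {x : Fin 5 → Holed (Fin 4)},
      (∀ t, inflate (polyWord c (e t)) (x (e t)) = v t) ↔
      (∀ t, x (e t) = v₀ t) ∧ ∀ t p, (v t).1 = some p → polyWord c (e t) = p.1 := by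
    simp [inflate_eq_iff, forall_and, hv₀]
  have hj : holeCount v₀ ≤ 3 := Finset.card_le_univ _
  rcases hj.lt_or_eq with hj | hj
  · -- The group indices of the coordinates in `N` are prescribed; they determine the polynomial.
    let N : Finset (Fin 3) := Finset.univ.filter fun t => ¬ (v₀ t).1.isNone = true
    have hN : N.card + holeCount v₀ = 3 := by
      have := Finset.card_filter_add_card_filter_not (s := (Finset.univ : Finset (Fin 3)))
        (fun t => (v₀ t).1.isNone = true)
      rw [Finset.card_univ, Fintype.card_fin] at this
      rw [add_comm]; exact this
    -- The default value `0` is never read: `t ∈ N` means that `v t` is not in the hole.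
    have hmemN : ∀ (c : Fin 3 → ZMod m), (∀ t p, (v t).1 = some p → polyWord c (e t) = p.1) ↔
        ∀ t ∈ N, polyWord c (e t) = ((v t).1.map Prod.fst).getD 0 := by
      intro c
      refine forall_congr' fun t => ?_
      rcases h : (v t).1 with _ | p <;> simp [N, hv₀, deflate, h]
    obtain ⟨c, ⟨hc, hcN⟩, hc'⟩ := existsUnique_polyWord hm he N hN (by omega)
      fun t => ((v t).1.map Prod.fst).getD 0
    obtain ⟨x, ⟨hx, hxv⟩, hx'⟩ := existsUnique_ingredient he (c := c) hc
    refine ⟨_, ⟨⟨c, x, hx, rfl⟩, hmatch.2 ⟨hxv, (hmemN c).2 hcN⟩⟩, ?_⟩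
    rintro _ ⟨⟨c₁, x₁, hx₁, rfl⟩, h⟩
    obtain ⟨h1, h2⟩ := hmatch.1 h
    obtain rfl : c₁ = c := by
      refine hc' _ ⟨fun l hl h3 => coeff_eq_zero_of_mem_ingredient he hx₁ hl ?_, (hmemN _).1 h2⟩
      rwa [funext h1]
    rw [hx' x₁ ⟨hx₁, h1⟩]
  · -- All three coordinates are in the hole, hence so is the whole word, and inflating it gives the
    -- same word for every constant polynomial.
    have hnone : ∀ t, (v₀ t).1 = none := by
      intro t
      have := Finset.card_eq_iff_eq_univ _ |>.1 (hj.trans (Fintype.card_fin 3).symm)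
      simpa using Finset.ext_iff.1 this t
    have hvnone : ∀ t p, (v t).1 ≠ some p := by
      intro t p h
      simpa [hv₀, deflate, h] using hnone t
    obtain ⟨x, ⟨hx, hxv⟩, hx'⟩ := hasStrengthThree_holeCode e he v₀
    refine ⟨_, ⟨⟨0, x, by simp [ingredient, hx], rfl⟩,
      hmatch.2 ⟨hxv, fun t p h => absurd h (hvnone t p)⟩⟩, ?_⟩
    rintro _ ⟨⟨c₁, x₁, hx₁, rfl⟩, h⟩
    obtain ⟨h1, -⟩ := hmatch.1 h
    have hc : ∀ l : Fin 3, l ≠ 0 → c₁ l = 0 := fun l hl =>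
      coeff_eq_zero_of_mem_ingredient he hx₁ hl (by rw [funext h1, hj]; omega)
    obtain rfl : x₁ = x := hx' _ ⟨by simpa [ingredient, hc 1, hc 2] using hx₁, h1⟩
    funext k
    have hk := eq_none_of_mem_holeCode he hx (fun t => by rw [hxv, hnone]) k
    simp [inflate, hk]

/-! ### Strength-three codes as pairs of orthogonal latin cubes -/

theorem HasStrengthThree.isMDSCode {q : ℕ} {C : Set (Fin 5 → Fin q)}
    (hC : HasStrengthThree C) : IsMDSCode 2 5 q C := by
  intro S x hS
  have hS' : Sᶜ.card = 3 := by rw [Finset.card_compl, hS, Fintype.card_fin]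
  let e := Sᶜ.orderEmbOfFin hS'
  refine (existsUnique_congr fun y => ?_).1 (hC e e.injective fun t => x (e t))
  have : ∀ k, k ∉ S ↔ k ∈ Set.range e := by
    intro k
    rw [Finset.range_orderEmbOfFin, Finset.mem_coe, Finset.mem_compl]
  simp only [Set.mem_inter_iff, axisPlane, Set.mem_ofPred_eq, this, Set.forall_mem_range]

/-- The first three coordinates of a codeword are free and determine the other two. -/
theorem HasStrengthThree.exists_graph {q : ℕ} {C : Set (Fin 5 → Fin q)} (hC : HasStrengthThree C) :
    ∃ f g : (Fin 3 → Fin q) → Fin q,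
      C = {w | ∃ x : Fin 3 → Fin q, w = ![x 0, x 1, x 2, f x, g x]} := by
  choose W hW hW' using hC (Fin.castLE (by norm_num)) (Fin.castLE_injective _)
  refine ⟨fun x => W x 3, fun x => W x 4, ?_⟩
  have key : ∀ x, W x = ![x 0, x 1, x 2, W x 3, W x 4] := by
    intro x
    have := (hW x).2
    funext k
    fin_cases k
    exacts [this 0, this 1, this 2, rfl, rfl]
  ext w
  constructor
  · intro hw
    exact ⟨fun t => w (t.castLE (by norm_num)),
      (hW' _ w ⟨hw, fun t => rfl⟩).trans (key _)⟩
  · rintro ⟨x, rfl⟩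
    rw [← key]
    exact (hW x).1

/-- Each defining property of the cubes prescribes three of the five coordinates of a codeword: two
arguments and one value on a line, one argument and both values on a face. -/
theorem HasStrengthThree.areOrthogonalLatinCubes {q : ℕ} {C : Set (Fin 5 → Fin q)}
    (hC : HasStrengthThree C) {f g : (Fin 3 → Fin q) → Fin q}
    (hfg : C = {w | ∃ x : Fin 3 → Fin q, w = ![x 0, x 1, x 2, f x, g x]}) :
    AreOrthogonalLatinCubes f g := by
  have hgraph : ∀ e : Fin 3 → Fin 5, Function.Injective e → ∀ v : Fin 3 → Fin q,
      ∃! x : Fin 3 → Fin q, ∀ t, ![x 0, x 1, x 2, f x, g x] (e t) = v t := by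
    intro e he v
    subst hfg
    obtain ⟨_, ⟨⟨x, rfl⟩, hx⟩, hx'⟩ := hC e he v
    refine ⟨x, hx, fun y hy => ?_⟩
    have := hx' _ ⟨⟨y, rfl⟩, hy⟩
    funext t
    fin_cases t
    exacts [congrFun this 0, congrFun this 1, congrFun this 2]
  have hcoord : ∀ (x : Fin 3 → Fin q) (t : Fin 3),
      ![x 0, x 1, x 2, f x, g x] (t.castLE (by norm_num)) = x t := by
    intro x t; fin_cases t <;> rfl
  have hline : ∀ (h : (Fin 3 → Fin q) → Fin q) (p : Fin 5), 3 ≤ p →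
      (∀ x : Fin 3 → Fin q, ![x 0, x 1, x 2, f x, g x] p = h x) → IsLatinCube h := by
    intro h p hp hh i x
    rw [Function.bijective_iff_existsUnique]
    intro b
    -- Prescribe the value `b` in place of the `i`-th argument.
    have he : Function.Injective fun t : Fin 3 => if t = i then p else t.castLE (by norm_num) := by
      clear * - hp
      revert p i
      decide
    obtain ⟨y, hy, hy'⟩ := hgraph _ he fun t => if t = i then b else x t
    have hyx : y = Function.update x i (y i) := by
      funext t
      by_cases ht : t = i
      · subst ht; simp
      · simpa [ht, hcoord] using hy t
    refine ⟨y i, ?_, fun a ha => ?_⟩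
    · simpa [← hyx, hh] using hy i
    · rw [← hy' (Function.update x i a) fun t => ?_]
      · simp
      · by_cases ht : t = i
        · subst ht; simpa [hh] using ha
        · simp [ht, hcoord]
  refine ⟨hline f 3 le_rfl fun x => rfl, hline g 4 (by decide) fun x => rfl, ?_⟩
  intro i j x hij
  rw [Function.bijective_iff_existsUnique]
  rintro ⟨b, c⟩
  -- Prescribe the two values `b`, `c` in place of the `i`-th and `j`-th arguments.
  have he : Function.Injective fun t : Fin 3 =>
      if t = i then (3 : Fin 5) else if t = j then 4 else t.castLE (by norm_num) := by
    revert i j; decide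
  obtain ⟨y, hy, hy'⟩ := hgraph _ he fun t => if t = i then b else if t = j then c else x t
  have hyx : y = Function.update (Function.update x i (y i)) j (y j) := by
    funext t
    by_cases hj : t = j
    · subst hj; simp
    by_cases hi : t = i
    · subst hi; simp [hj]
    · simpa [hi, hj, hcoord] using hy t
  refine ⟨(y i, y j), ?_, fun a ha => ?_⟩
  · have h1 := hy i
    have h2 := hy j
    simp [hij.symm] at h1 h2
    simp [← hyx, h1, h2]
  · obtain ⟨h1, h2⟩ := Prod.ext_iff.1 ha
    rw [← hy' (Function.update (Function.update x i a.1) j a.2) fun t => ?_]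
    · simp [hij]
    · by_cases hi : t = i
      · subst hi; simpa using h1
      by_cases hj : t = j
      · subst hj; simpa [hi] using h2
      · simp [hi, hj, hcoord]

/-! ### Transfer to the orders in question -/

theorem exists_coprime_six {q : ℕ} {s : ℤ}
    (hq : (q : ℤ) = 16 * (6 * s + 1) + 4 ∨ (q : ℤ) = 16 * (6 * s - 1) + 4) :
    ∃ m : ℕ, 0 < m ∧ m.Coprime 6 ∧ q = 16 * m + 4 := by
  obtain ⟨m, hm⟩ : ∃ m : ℕ, (m : ℤ) = 6 * s + 1 ∧ q = 16 * m + 4 ∨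
      (m : ℤ) = 6 * s - 1 ∧ q = 16 * m + 4 := by
    exact ⟨(q - 4) / 16, by omega⟩
  have h2 : m.Coprime 2 := by rw [Nat.coprime_two_right]; rw [Nat.odd_iff]; omega
  have h3 : m.Coprime 3 := by
    rw [Nat.coprime_comm, Nat.Prime.coprime_iff_not_dvd Nat.prime_three]; omega
  exact ⟨m, by omega, h2.mul_right h3, by omega⟩

theorem mainTheorem1 (q : ℕ) (s : ℤ)
    (hq : (q : ℤ) = 16 * (6 * s + 1) + 4 ∨ (q : ℤ) = 16 * (6 * s - 1) + 4) :
    ∃ C : Set (Fin 5 → Fin q), IsMDSCode 2 5 q C ∧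
      ∃ f g : (Fin 3 → Fin q) → Fin q, AreOrthogonalLatinCubes f g ∧
        C = {w | ∃ x : Fin 3 → Fin q, w = ![x 0, x 1, x 2, f x, g x]} := by
  obtain ⟨m, hm0, hm, rfl⟩ := exists_coprime_six hq
  have : NeZero m := ⟨hm0.ne'⟩
  have hcard : Fintype.card (Holed (ZMod m × Fin 4)) = 16 * m + 4 := by
    simp [ZMod.card]; ring
  let φ := Fintype.equivFinOfCardEq hcard
  have hC : HasStrengthThree {w : Fin 5 → Fin (16 * m + 4) | φ.symm ∘ w ∈ wilsonCode m} := by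
    intro e he v
    refine (existsUnique_congr fun w => and_congr Iff.rfl (forall_congr' fun t => ?_)).1
      (((Equiv.refl (Fin 5)).arrowCongr φ).existsUnique_congr_left.1
        (hasStrengthThree_wilsonCode hm e he (φ.symm ∘ v)))
    exact φ.symm.injective.eq_iff
  obtain ⟨f, g, hfg⟩ := hC.exists_graph
  exact ⟨_, hC.isMDSCode, f, g, hC.areOrthogonalLatinCubes hfg, hfg⟩
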